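/- Let $G$ be an infinite, locally finite (every vertex has finite degree), connected simple graph that is claw-free and net-free, i.e. no induced subgraph of $G$ is isomorphic to the claw $K_{1,3}$ or to the net (the graph on six vertices obtained from a triangle by attaching one pendant edge at each of its three vertices). A ray of $G$ is a one-way infinite path in $G$, and a double ray of $G$ is a two-way infinite path in $G$; it is spanning if it contains all vertices of $G$. Two rays are equivalent if for every finite set $S \subseteq V(G)$ they have tails in the same component of $G - S$, and the ends of $G$ are the equivalence classes of rays. Then precisely one of the following two statements holds: - $G$ has exactly one end and admits a spanning ray. - $G$ has exactly two ends and admits a spanning double ray. -/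

import Mathlib

open Filter

namespace SimpleGraph

/-- The claw `K_{1,3}`: the vertex `0` is joined to `1`, `2`, `3`. -/
def claw : SimpleGraph (Fin 4) := starGraph 0

/-- The net: a triangle `0, 1, 2` with one pendant edge attached at each of its vertices. -/
def net : SimpleGraph (Fin 6) :=
  fromEdgeSet {s(0, 1), s(1, 2), s(0, 2), s(0, 3), s(1, 4), s(2, 5)}

/-- `G` is `H`-free: no induced subgraph of `G` is isomorphic to `H`. -/
def IsInducedFree {W V : Type*} (H : SimpleGraph W) (G : SimpleGraph V) : Prop :=
  ¬ H.IsIndContained G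

/-- A ray of `G`, i.e. a one-way infinite path, listed from its start vertex. -/
@[ext]
structure Ray {V : Type*} (G : SimpleGraph V) where
  vert : ℕ → V
  injective : Function.Injective vert
  adj : ∀ n, G.Adj (vert n) (vert (n + 1))

/-- A double ray of `G`, i.e. a two-way infinite path, with an enumeration of its vertices. -/
@[ext]
structure DoubleRay {V : Type*} (G : SimpleGraph V) where
  vert : ℤ → V
  injective : Function.Injective vert
  adj : ∀ n, G.Adj (vert n) (vert (n + 1))

/-- The ray contains all vertices of `G`. -/
def Ray.IsSpanning {V : Type*} {G : SimpleGraph V} (R : G.Ray) : Prop :=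
  Function.Surjective R.vert

/-- The double ray contains all vertices of `G`. -/
def DoubleRay.IsSpanning {V : Type*} {G : SimpleGraph V} (D : G.DoubleRay) : Prop :=
  Function.Surjective D.vert

/-- Some tail of `R` lies in the component `C` of `G - S`. -/
def Ray.HasTailIn {V : Type*} {G : SimpleGraph V} (R : G.Ray) {S : Set V}
    (C : G.ComponentCompl S) : Prop :=
  ∃ N, ∀ n, N ≤ n → R.vert n ∈ C

/-- Two rays are equivalent if no finite vertex set separates them: for every finite `S` they have
tails in the same component of `G - S`. -/
def Ray.Equivalent {V : Type*} {G : SimpleGraph V} (R R' : G.Ray) : Prop :=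
  ∀ S : Finset V, ∃ C : G.ComponentCompl (S : Set V), R.HasTailIn C ∧ R'.HasTailIn C

theorem Ray.exists_hasTailIn {V : Type*} {G : SimpleGraph V} (R : G.Ray) (S : Finset V) :
    ∃ C : G.ComponentCompl (S : Set V), R.HasTailIn C := by
  have h : ∀ᶠ n in atTop, R.vert n ∉ (S : Set V) := by
    rw [← Nat.cofinite_eq_atTop]
    exact R.injective.tendsto_cofinite.eventually S.finite_toSet.compl_mem_cofinite
  obtain ⟨N, hN⟩ := eventually_atTop.1 h
  refine ⟨G.componentComplMk (hN N le_rfl), N, fun n hn => ?_⟩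
  induction n, hn using Nat.le_induction with
  | base => exact G.componentComplMk_mem _
  | succ n hn ih => exact ComponentCompl.mem_of_adj _ _ ih (hN _ (by omega)) (R.adj n)

theorem Ray.HasTailIn.unique {V : Type*} {G : SimpleGraph V} {R : G.Ray} {S : Set V}
    {C D : G.ComponentCompl S} (hC : R.HasTailIn C) (hD : R.HasTailIn D) : C = D := by
  obtain ⟨M, hM⟩ := hC
  obtain ⟨N, hN⟩ := hD
  obtain ⟨_, h1⟩ := hM (max M N) (le_max_left _ _)
  obtain ⟨_, h2⟩ := hN (max M N) (le_max_right _ _)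
  exact h1.symm.trans h2

theorem Ray.equivalent_equivalence {V : Type*} (G : SimpleGraph V) :
    Equivalence (Ray.Equivalent (G := G)) where
  refl R S := (R.exists_hasTailIn S).imp fun _ h => ⟨h, h⟩
  symm h S := (h S).imp fun _ h => ⟨h.2, h.1⟩
  trans h h' S := by
    obtain ⟨C, h1, h2⟩ := h S
    obtain ⟨D, h3, h4⟩ := h' S
    obtain rfl := h2.unique h3
    exact ⟨C, h1, h4⟩

/-- Equivalence of rays as a setoid. -/
def raySetoid {V : Type*} (G : SimpleGraph V) : Setoid G.Ray :=
  ⟨Ray.Equivalent, Ray.equivalent_equivalence G⟩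

/-- The ends of `G`: the equivalence classes of rays. -/
def RayEnd {V : Type*} (G : SimpleGraph V) : Type _ := Quotient G.raySetoid

end SimpleGraph

/-! Start from an induced ray, which exists by König's lemma. If only finitely many vertices have no
neighbour on it, its beginning can be rerouted until every vertex has one
(`IsInducedRay.exists_dominating`). Otherwise a second geodesic ray leaves it near its start, and
the two glue to an induced double ray (`IsInducedRay.exists_isInducedDoubleRay`), which always
dominates. Both cases rest on the forbidden configuration `false_of_induced_path`.

Given a dominating induced path `f`, sort the vertices by the index `i` of their last neighbour on
`f`. By claw-freeness each layer is a clique; it is finite, and `f i` lies in layer `i + 1` and is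
adjacent to all of layer `i`. Running through the layers in turn, entering layer `i + 1` at `f i`,
gives the spanning ray or double ray.

By local finiteness every ray is equivalent to the dominating ray, or to one of the two halves of
the double ray. The halves are inequivalent: the neighbours of `f 0` and `f 1` separate them. -/

namespace SimpleGraph

variable {V : Type*} {G : SimpleGraph V}

/-! ### Claws and nets -/

theorem IsInducedFree.adj_of_claw (h : IsInducedFree claw G) {x a b c : V}
    (hxa : G.Adj x a) (hxb : G.Adj x b) (hxc : G.Adj x c) (hab : a ≠ b) (hac : a ≠ c)
    (hbc : b ≠ c) : G.Adj a b ∨ G.Adj a c ∨ G.Adj b c := by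
  by_contra! hn
  obtain ⟨h1, h2, h3⟩ := hn
  have key : ∀ i j, G.Adj (![x, a, b, c] i) (![x, a, b, c] j) ↔ claw.Adj i j := by
    intro i j
    fin_cases i <;> fin_cases j <;>
      simp [claw, starGraph, hxa, hxb, hxc, h1, h2, h3, hxa.symm, hxb.symm, hxc.symm,
        G.adj_comm b a, G.adj_comm c a, G.adj_comm c b]
  refine h ⟨⟨⟨![x, a, b, c], fun i j hij => ?_⟩, key _ _⟩⟩
  fin_cases i <;> fin_cases j <;>
    simp_all [hxa.ne, hxb.ne, hxc.ne, hxa.ne', hxb.ne', hxc.ne', hab.symm, hac.symm, hbc.symm]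

theorem IsInducedFree.false_of_net (h : IsInducedFree net G) {a b c a' b' c' : V}
    (hab : G.Adj a b) (hbc : G.Adj b c) (hac : G.Adj a c)
    (haa' : G.Adj a a') (hbb' : G.Adj b b') (hcc' : G.Adj c c')
    (hab' : ¬ G.Adj a b') (hac' : ¬ G.Adj a c') (hba' : ¬ G.Adj b a') (hbc' : ¬ G.Adj b c')
    (hca' : ¬ G.Adj c a') (hcb' : ¬ G.Adj c b')
    (ha'b' : ¬ G.Adj a' b') (ha'c' : ¬ G.Adj a' c') (hb'c' : ¬ G.Adj b' c') : False := by
  have key : ∀ i j, G.Adj (![a, b, c, a', b', c'] i) (![a, b, c, a', b', c'] j) ↔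
      net.Adj i j := by
    intro i j
    fin_cases i <;> fin_cases j <;>
      simp [net, hab, hbc, hac, haa', hbb', hcc', hab', hac', hba', hbc', hca', hcb', ha'b',
        ha'c', hb'c', hab.symm, hbc.symm, hac.symm, haa'.symm, hbb'.symm, hcc'.symm,
        G.adj_comm a' b, G.adj_comm a' c, G.adj_comm b' a, G.adj_comm b' c, G.adj_comm c' a,
        G.adj_comm c' b, G.adj_comm b' a', G.adj_comm c' a', G.adj_comm c' b']
  -- No two vertices of the net have the same neighbourhood, so preserving and reflecting adjacency
  -- already forces injectivity.
  have twin : ∀ i j : Fin 6, (∀ k, net.Adj i k ↔ net.Adj j k) → i = j := by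
    simp only [net, fromEdgeSet_adj, Set.mem_insert_iff, Set.mem_singleton_iff]
    decide
  refine h ⟨⟨⟨![a, b, c, a', b', c'], fun i j hij => twin i j fun k => ?_⟩, key _ _⟩⟩
  rw [← key, ← key, hij]

/-- In a claw-free and net-free graph, a vertex `v` outside an induced path `a, b, c, d` which is
adjacent to `c` but not to `d` has no neighbour that is nonadjacent to all of the path. -/
theorem false_of_induced_path (hclaw : IsInducedFree claw G) (hnet : IsInducedFree net G)
    {a b c d v w : V} (hab : G.Adj a b) (hbc : G.Adj b c) (hcd : G.Adj c d)
    (hac : ¬ G.Adj a c) (had : ¬ G.Adj a d) (hbd : ¬ G.Adj b d)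
    (hvc : G.Adj v c) (hvd : ¬ G.Adj v d) (hvw : G.Adj v w) (hvb' : v ≠ b) (hvd' : v ≠ d)
    (hwa : ¬ G.Adj w a) (hwb : ¬ G.Adj w b) (hwc : ¬ G.Adj w c) (hwd : ¬ G.Adj w d) : False := by
  have hbd' : b ≠ d := by rintro rfl; exact had hab
  have hvb : G.Adj v b := by
    rcases hclaw.adj_of_claw hbc.symm hcd hvc.symm hbd' hvb'.symm hvd'.symm with h | h | h
    · exact absurd h hbd
    · exact h.symm
    · exact absurd h.symm hvd
  -- If `v` sees `a`, then `v; a, c, w` is a claw; otherwise the triangle `v, c, b` with pendants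
  -- `w, d, a` is a net.
  by_cases hva : G.Adj v a
  · have h1 : a ≠ c := by rintro rfl; exact had hcd
    have h2 : a ≠ w := by rintro rfl; exact hwb hab
    have h3 : c ≠ w := by rintro rfl; exact hwd hcd
    rcases hclaw.adj_of_claw hva hvc hvw h1 h2 h3 with h | h | h
    · exact hac h
    · exact hwa h.symm
    · exact hwc h.symm
  · exact hnet.false_of_net hvc hbc.symm hvb hvw hcd hab.symm hvd hva (mt Adj.symm hwc)
      (mt Adj.symm hac) (mt Adj.symm hwb) hbd hwd hwa (mt Adj.symm had)

/-! ### Induced rays and double rays -/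

/-- The sequence `f` traces an induced ray of `G`. -/
def IsInducedRay (G : SimpleGraph V) (f : ℕ → V) : Prop :=
  ∀ m n, G.Adj (f m) (f n) ↔ n = m + 1 ∨ m = n + 1

/-- The sequence `f` traces an induced double ray of `G`. -/
def IsInducedDoubleRay (G : SimpleGraph V) (f : ℤ → V) : Prop :=
  ∀ m n, G.Adj (f m) (f n) ↔ n = m + 1 ∨ m = n + 1

theorem IsInducedRay.injective {f : ℕ → V} (hf : G.IsInducedRay f) : Function.Injective f := by
  intro i j hij
  have h1 := hf i (i + 1)
  have h2 := hf j (j + 1)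
  have h3 := hf j (i + 1)
  have h4 := hf i (j + 1)
  rw [hij] at h1 h4
  grind

theorem IsInducedDoubleRay.injective {f : ℤ → V} (hf : G.IsInducedDoubleRay f) :
    Function.Injective f := by
  intro i j hij
  have h1 := hf i (i + 1)
  have h2 := hf j (j + 1)
  have h3 := hf j (i + 1)
  have h4 := hf i (j + 1)
  rw [hij] at h1 h4
  grind

theorem IsInducedRay.comp_add {f : ℕ → V} (hf : G.IsInducedRay f) (k : ℕ) :
    G.IsInducedRay fun n => f (n + k) := fun m n => by
  rw [hf]; omega

theorem IsInducedRay.cons {f : ℕ → V} (hf : G.IsInducedRay f) {y : V}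
    (hy : ∀ n, G.Adj y (f n) ↔ n = 0) : G.IsInducedRay fun n => Nat.casesOn n y f := by
  rintro (_ | m) (_ | n)
  · simp
  · simp [hy]
  · simp [G.adj_comm _ y, hy]
  · simp only [hf m n]; omega

theorem finite_setOf_adj [G.LocallyFinite] (v : V) : {w | G.Adj v w}.Finite :=
  (G.neighborSet v).toFinite

theorem finite_setOf_adj_apply [G.LocallyFinite] {ι : Type*} {f : ι → V}
    (hf : Function.Injective f) (v : V) : {i | G.Adj v (f i)}.Finite :=
  (finite_setOf_adj v).preimage hf.injOn

theorem exists_last_adj [G.LocallyFinite] {ι : Type*} [LinearOrder ι] {f : ι → V}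
    (hf : Function.Injective f) {v : V} {j : ι} (h : G.Adj v (f j)) :
    ∃ i, G.Adj v (f i) ∧ j ≤ i ∧ ∀ k, G.Adj v (f k) → k ≤ i := by
  obtain ⟨i, hi, hmax⟩ :=
    Set.exists_max_image _ id (finite_setOf_adj_apply hf v) ⟨j, h⟩
  exact ⟨i, hi, hmax j h, hmax⟩

theorem Connected.exists_adj_boundary (hconn : G.Connected) {S : Set V} {a b : V} (ha : a ∈ S)
    (hb : b ∉ S) : ∃ x ∈ S, ∃ y ∉ S, G.Adj x y := by
  obtain ⟨p⟩ := hconn.preconnected a b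
  obtain ⟨d, -, h1, h2⟩ := p.exists_boundary_dart S ha hb
  exact ⟨_, h1, _, h2, d.adj⟩

/-- Otherwise some edge joins an undominated `x` to a dominated `y`. Around the last neighbour `f i`
of `y`, the path `f (i - 2), …, f (i + 1)` with `y` and `x` is the configuration excluded by
`false_of_induced_path`. -/
theorem IsInducedDoubleRay.dominating [G.LocallyFinite] (hconn : G.Connected)
    (hclaw : IsInducedFree claw G) (hnet : IsInducedFree net G) {f : ℤ → V}
    (hf : G.IsInducedDoubleRay f) (v : V) : ∃ i, G.Adj v (f i) := by
  by_contra hv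
  obtain ⟨x, hx, y, hy, hxy⟩ := hconn.exists_adj_boundary (S := {v | ¬ ∃ i, G.Adj v (f i)})
    (a := v) (b := f 0) hv (by simpa using ⟨1, (hf 0 1).2 (by simp)⟩)
  simp only [Set.mem_ofPred_eq, not_exists, not_forall, not_not] at hx hy
  obtain ⟨j, hj⟩ := hy
  obtain ⟨i, hi, -, hmax⟩ := exists_last_adj hf.injective hj
  have hyf : ∀ k, y ≠ f k := by rintro k rfl; exact hx k hxy
  refine false_of_induced_path hclaw hnet (a := f (i - 2)) (b := f (i - 1)) (c := f i)
    (d := f (i + 1)) (v := y) (w := x) ?_ ?_ ?_ ?_ ?_ ?_ hi (fun h => ?_) hxy.symm (hyf _) (hyf _)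
    (hx _) (hx _) (hx _) (hx _)
  any_goals rw [hf]; omega
  have := hmax _ h
  omega

/-- The vertices with no neighbour among the `f i`. -/
def undominated (G : SimpleGraph V) {ι : Type*} (f : ι → V) : Set V :=
  {v | ∀ i, ¬ G.Adj v (f i)}

/-- The argument for double rays needs two predecessors of the last neighbour `f i` of `y`, so it
leaves only `i ≤ 1`. For `i = 1`, the claw at `f 1` forces `y` to see `f 0`. -/
theorem IsInducedRay.adj_zero_of_adj_undominated [G.LocallyFinite]
    (hclaw : IsInducedFree claw G) (hnet : IsInducedFree net G) {f : ℕ → V}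
    (hf : G.IsInducedRay f) {x y : V} (hx : x ∈ G.undominated f) (hy : y ∉ G.undominated f)
    (hxy : G.Adj x y) : G.Adj y (f 0) ∧ ∀ k, G.Adj y (f k) → k ≤ 1 := by
  simp only [undominated, Set.mem_ofPred_eq, not_forall, not_not] at hx hy
  obtain ⟨j, hj⟩ := hy
  obtain ⟨i, hi, -, hmax⟩ := exists_last_adj hf.injective hj
  have hyf : ∀ k, y ≠ f k := by rintro k rfl; exact hx k hxy
  have hyi : ¬ G.Adj y (f (i + 1)) := fun h => by have := hmax _ h; omega
  obtain rfl | rfl | ⟨i, rfl⟩ : i = 0 ∨ i = 1 ∨ ∃ k, i = k + 2 := by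
    rcases i with _ | _ | i <;> simp
  · exact ⟨hi, fun k hk => (hmax k hk).trans zero_le_one⟩
  · refine ⟨?_, hmax⟩
    rcases hclaw.adj_of_claw ((hf 1 0).2 (by simp)) ((hf 1 2).2 (by simp)) hi.symm
      (hf.injective.ne (by simp)) (hyf 0).symm (hyf 2).symm with h | h | h
    · rw [hf] at h; omega
    · exact h.symm
    · exact absurd h.symm hyi
  · refine (false_of_induced_path hclaw hnet (a := f i) (b := f (i + 1)) (c := f (i + 2))
      (d := f (i + 3)) (v := y) (w := x) ?_ ?_ ?_ ?_ ?_ ?_ hi hyi hxy.symm (hyf _) (hyf _)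
      (hx _) (hx _) (hx _) (hx _)).elim
    all_goals rw [hf]; omega

/-- A neighbour `y` of an undominated `x` becomes the new first vertex, which dominates `x`. If `y`
sees `f 1`, then `f 0` must be dropped to keep the ray induced. -/
theorem IsInducedRay.exists_undominated_ssubset [G.LocallyFinite] (hconn : G.Connected)
    (hclaw : IsInducedFree claw G) (hnet : IsInducedFree net G) {f : ℕ → V}
    (hf : G.IsInducedRay f) (hne : (G.undominated f).Nonempty) :
    ∃ g, G.IsInducedRay g ∧ G.undominated g ⊂ G.undominated f := by
  by_cases hcase : ∃ x ∈ G.undominated f, ∃ y, G.Adj x y ∧ G.Adj y (f 0) ∧ ¬ G.Adj y (f 1)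
  · obtain ⟨x, hx, y, hxy, hy0, hy1⟩ := hcase
    have hy := (hf.adj_zero_of_adj_undominated hclaw hnet hx (fun h => h 0 hy0) hxy).2
    refine ⟨_, hf.cons (y := y) fun n => ⟨fun h => ?_, ?_⟩, fun v hv i => hv (i + 1),
      fun h => h hx 0 hxy⟩
    · obtain _ | n := n
      · rfl
      · have := hy _ h
        obtain rfl : n = 0 := by omega
        exact absurd h hy1
    · rintro rfl; exact hy0
  · push Not at hcase
    obtain ⟨v, hv⟩ := hne
    obtain ⟨x, hx, y, hy, hxy⟩ := hconn.exists_adj_boundary (b := f 0) hv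
      (fun h => h 1 ((hf 0 1).2 (by simp)))
    obtain ⟨hy0, hyk⟩ := hf.adj_zero_of_adj_undominated hclaw hnet hx hy hxy
    have hy1 := hcase x hx y hxy hy0
    have hy2 : ¬ G.Adj y (f 2) := fun h => by have := hyk _ h; omega
    refine ⟨_, (hf.comp_add 1).cons (y := y) fun n => ⟨fun h => ?_, ?_⟩, fun v hv i => ?_,
      fun h => h hx 0 hxy⟩
    · have := hyk _ h
      omega
    · rintro rfl; exact hy1
    · have hvn : ∀ n, ¬ G.Adj v (f (n + 1)) := fun n => hv (n + 1)
      obtain _ | i := i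
      · intro hv0
        refine hnet.false_of_net (a := y) (b := f 0) (c := f 1) (a' := x) (b' := v) (c' := f 2)
          hy0 ((hf _ _).2 (by simp)) hy1 hxy.symm hv0.symm ((hf _ _).2 (by simp))
          (fun h => hv 0 h.symm) hy2 (fun h => hx _ h.symm) (by rw [hf]; simp)
          (fun h => hx _ h.symm) (fun h => hvn 0 h.symm) (fun h => ?_) (hx 2) (hvn 1)
        exact hvn 0 (hcase x hx v h hv0)
      · exact hvn i

theorem IsInducedRay.exists_dominating [G.LocallyFinite] (hconn : G.Connected)
    (hclaw : IsInducedFree claw G) (hnet : IsInducedFree net G) {f : ℕ → V}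
    (hf : G.IsInducedRay f) (hfin : (G.undominated f).Finite) :
    ∃ g, G.IsInducedRay g ∧ ∀ v, ∃ i, G.Adj v (g i) := by
  induction hn : (G.undominated f).ncard using Nat.strong_induction_on generalizing f with
  | _ n ih =>
    subst hn
    by_cases hne : (G.undominated f).Nonempty
    · obtain ⟨g, hg, hss⟩ := hf.exists_undominated_ssubset hconn hclaw hnet hne
      exact ih _ (Set.ncard_lt_ncard hss hfin) hg (hfin.subset hss.subset) rfl
    · refine ⟨f, hf, fun v => ?_⟩
      by_contra! hv
      exact hne ⟨v, hv⟩

/-! ### Geodesic rays -/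

/-- A form of König's lemma: a point with infinitely many iterated preimages
starts an infinite chain of preimages. -/
theorem exists_preimage_seq {p : V → V} (hp : ∀ v, {c | p c = v}.Finite) {v : V}
    (hv : {z | ∃ k, p^[k] z = v}.Infinite) :
    ∃ f : ℕ → V, f 0 = v ∧ ∀ n, p (f (n + 1)) = f n ∧ f (n + 1) ≠ f n := by
  have step : ∀ v, {z | ∃ k, p^[k] z = v}.Infinite →
      ∃ c, (p c = v ∧ c ≠ v) ∧ {z | ∃ k, p^[k] z = c}.Infinite := by
    intro v hv
    by_contra! hc
    have hfin := ((hp v).inter_of_left {c | c ≠ v}).biUnion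
      (t := fun c => {z | ∃ k, p^[k] z = c}) hc
    refine hv ((hfin.insert v).subset ?_)
    rintro z ⟨k, hk⟩
    by_cases hz : z = v
    · exact Or.inl hz
    -- Shorten `k` to the first arrival at `v`: the point just before it is a preimage other than
    -- `v`, even if `p` fixes `v`.
    induction k with
    | zero => exact absurd hk hz
    | succ k ih =>
      by_cases hk' : p^[k] z = v
      · exact ih hk'
      · rw [Function.iterate_succ_apply'] at hk
        exact Or.inr (Set.mem_biUnion (show p^[k] z ∈ _ from ⟨hk, hk'⟩) ⟨k, rfl⟩)
  choose! c hc hc' using step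
  refine ⟨fun n => c^[n] v, rfl, fun n => ?_⟩
  simp only [Function.iterate_succ_apply']
  refine hc _ ?_
  induction n with
  | zero => exact hv
  | succ n ih => rw [Function.iterate_succ_apply']; exact hc' _ ih

/-- Distances `l` to a vertex set `S`, with a choice `p` of the next vertex on a geodesic. -/
structure IsDistParent (G : SimpleGraph V) (S : Set V) (l : V → ℕ) (p : V → V) : Prop where
  eq_zero_iff : ∀ v, l v = 0 ↔ v ∈ S
  le_succ : ∀ {u v}, G.Adj u v → l u ≤ l v + 1
  map_mem : ∀ v ∈ S, p v = v
  adj : ∀ v ∉ S, G.Adj v (p v)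
  map_notMem : ∀ v ∉ S, l v = l (p v) + 1

theorem Connected.exists_isDistParent (hconn : G.Connected) {S : Set V} (hS : S.Nonempty) :
    ∃ l p, G.IsDistParent S l p := by
  classical
  have hex : ∀ v, ∃ n, ∃ s ∈ S, ∃ q : G.Walk v s, q.length = n := by
    intro v
    obtain ⟨s, hs⟩ := hS
    obtain ⟨q⟩ := hconn.preconnected v s
    exact ⟨_, s, hs, q, rfl⟩
  have hmin : ∀ v s, s ∈ S → ∀ q : G.Walk v s, Nat.find (hex v) ≤ q.length :=
    fun v s hs q => Nat.find_min' _ ⟨s, hs, q, rfl⟩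
  have hle : ∀ {u v}, G.Adj u v → Nat.find (hex u) ≤ Nat.find (hex v) + 1 := by
    intro u v huv
    obtain ⟨s, hs, q, hq⟩ := Nat.find_spec (hex v)
    exact (hmin u s hs (q.cons huv)).trans (by rw [Walk.length_cons, hq])
  have hpar : ∀ v, v ∉ S → ∃ w, G.Adj v w ∧ Nat.find (hex v) = Nat.find (hex w) + 1 := by
    intro v hv
    obtain ⟨s, hs, q, hq⟩ := Nat.find_spec (hex v)
    cases q with
    | nil => exact absurd hs hv
    | @cons _ w _ h q =>
      refine ⟨w, h, (hle h).antisymm ?_⟩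
      rw [← hq, Walk.length_cons]
      exact Nat.succ_le_succ (hmin w s hs q)
  choose! p hp hp' using hpar
  refine ⟨fun v => Nat.find (hex v), fun v => if v ∈ S then v else p v, fun v => ?_, hle,
    fun v hv => if_pos hv, fun v hv => ?_, fun v hv => ?_⟩
  · rw [Nat.find_eq_zero]
    constructor
    · rintro ⟨s, hs, q, hq⟩
      rwa [Walk.eq_of_length_eq_zero hq]
    · intro hv
      exact ⟨v, hv, Walk.nil, rfl⟩
  · rw [if_neg hv]; exact hp v hv
  · rw [if_neg hv]; exact hp' v hv

namespace IsDistParent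

variable {S : Set V} {l : V → ℕ} {p : V → V}

/-- Along a chain of preimages the distance to `S` grows by one at each step, while it changes by at
most one along any edge; hence there are no chords. -/
theorem exists_geodesic [G.LocallyFinite] (h : G.IsDistParent S l p) {v : V}
    (hv : {z | ∃ k, p^[k] z = v}.Infinite) :
    ∃ f : ℕ → V, f 0 = v ∧ (∀ n, l (f n) = l v + n) ∧ G.IsInducedRay f := by
  have hfin : ∀ v, {c | p c = v}.Finite := by
    intro v
    refine ((finite_setOf_adj (G := G) v).insert v).subset ?_
    rintro c rfl
    by_cases hc : c ∈ S
    · exact Or.inl (h.map_mem c hc).symm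
    · exact Or.inr (h.adj c hc).symm
  obtain ⟨f, h0, hf⟩ := exists_preimage_seq hfin hv
  have hS : ∀ n, f (n + 1) ∉ S := fun n hn =>
    (hf n).2 ((h.map_mem _ hn).symm.trans (hf n).1)
  have hl : ∀ n, l (f n) = l v + n := by
    intro n
    induction n with
    | zero => rw [h0]; rfl
    | succ n ih => rw [h.map_notMem _ (hS n), (hf n).1, ih]; rfl
  have hadj : ∀ n, G.Adj (f n) (f (n + 1)) := by
    intro n
    have := (h.adj _ (hS n)).symm
    rwa [(hf n).1] at this
  refine ⟨f, h0, hl, fun m n => ⟨fun hmn => ?_, ?_⟩⟩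
  · have h1 := h.le_succ hmn
    have h2 := h.le_succ hmn.symm
    rw [hl, hl] at h1 h2
    have : m ≠ n := by rintro rfl; exact hmn.ne rfl
    omega
  · rintro (rfl | rfl)
    · exact hadj m
    · exact (hadj n).symm

theorem iterate_eq (h : G.IsDistParent S l p) (v : V) :
    ∀ k ≤ l v, l (p^[k] v) = l v - k
  | 0, _ => rfl
  | k + 1, hk => by
    have ih := h.iterate_eq v k (by omega)
    have hS : p^[k] v ∉ S := by rw [← h.eq_zero_iff]; omega
    have := h.map_notMem _ hS
    rw [Function.iterate_succ_apply']
    omega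

end IsDistParent

theorem exists_isInducedRay [Infinite V] [G.LocallyFinite] (hconn : G.Connected) :
    ∃ f, G.IsInducedRay f := by
  obtain ⟨v⟩ := hconn.nonempty
  obtain ⟨l, p, h⟩ := hconn.exists_isDistParent (Set.singleton_nonempty v)
  obtain ⟨f, -, -, hf⟩ := h.exists_geodesic (v := v) <| by
    convert Set.infinite_univ (α := V) using 1
    refine Set.eq_univ_of_forall fun z => ⟨l z, ?_⟩
    rw [← Set.mem_singleton_iff, ← h.eq_zero_iff, h.iterate_eq z _ le_rfl, Nat.sub_self]
  exact ⟨f, hf⟩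

theorem IsInducedRay.glue {f g : ℕ → V} (hf : G.IsInducedRay f) (hg : G.IsInducedRay g)
    (hfg : ∀ m n, G.Adj (f m) (g n) ↔ m = 0 ∧ n = 0) :
    G.IsInducedDoubleRay fun i => Int.casesOn i f g := by
  rintro (m | m) (n | n)
  · simp only [hf m n, Int.ofNat_eq_natCast]; omega
  · simp only [hfg m n, Int.ofNat_eq_natCast]; omega
  · simp only [G.adj_comm _ (f n), hfg n m, Int.ofNat_eq_natCast]; omega
  · simp only [hg m n]; omega

/-- Undominated vertices are those at distance at least 2 from `f`, and their geodesics to `f` pass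
through the finitely many neighbours of `f 0`. One of these, `y`, starts an infinite geodesic ray
leading away from `f`, whose only contact with `f` is from `y` to `f 0` and possibly `f 1`. -/
theorem IsInducedRay.exists_isInducedDoubleRay [G.LocallyFinite] (hconn : G.Connected)
    (hclaw : IsInducedFree claw G) (hnet : IsInducedFree net G) {f : ℕ → V}
    (hf : G.IsInducedRay f) (hinf : (G.undominated f).Infinite) :
    ∃ g, G.IsInducedDoubleRay g := by
  obtain ⟨l, p, h⟩ := hconn.exists_isDistParent (Set.range_nonempty f)
  have hl0 : ∀ i, l (f i) = 0 := fun i => (h.eq_zero_iff _).2 ⟨i, rfl⟩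
  have hund : ∀ v, v ∈ G.undominated f ↔ 2 ≤ l v := by
    refine fun v => ⟨fun hv => ?_, fun hv i hi => ?_⟩
    · have hvS : v ∉ Set.range f := by
        rintro ⟨i, rfl⟩; exact hv (i + 1) ((hf _ _).2 (by simp))
      have h1 := h.map_notMem v hvS
      by_contra! hlt
      obtain ⟨i, hi⟩ := (h.eq_zero_iff (p v)).1 (by omega)
      exact hv i (hi ▸ h.adj v hvS)
    · have := h.le_succ hi
      rw [hl0] at this
      omega
  have key : ∀ x y, G.Adj x y → 2 ≤ l x → l y = 1 →
      G.Adj y (f 0) ∧ ∀ k, G.Adj y (f k) → k ≤ 1 := fun x y hxy hx hy =>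
    hf.adj_zero_of_adj_undominated hclaw hnet ((hund x).2 hx) (by rw [hund]; omega) hxy
  obtain ⟨y, hy1, hyinf⟩ : ∃ y, l y = 1 ∧ {z | ∃ k, p^[k] z = y}.Infinite := by
    by_contra! hc
    have hfin := ((finite_setOf_adj (G := G) (f 0)).inter_of_left {y | l y = 1}).biUnion
      (t := fun y => {z | ∃ k, p^[k] z = y}) fun y hy => hc y hy.2
    refine hinf (hfin.subset fun x hx => ?_)
    rw [hund] at hx
    have h1 := h.iterate_eq x (l x - 1) (by omega)
    have h2 := h.iterate_eq x (l x - 2) (by omega)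
    have h3 : p (p^[l x - 2] x) = p^[l x - 1] x := by
      rw [← Function.iterate_succ_apply' p, show (l x - 2).succ = l x - 1 by omega]
    have h4 : p^[l x - 2] x ∉ Set.range f := by rw [← h.eq_zero_iff]; omega
    have h5 := h.adj _ h4
    rw [h3] at h5
    exact Set.mem_biUnion (show p^[l x - 1] x ∈ _ from
      ⟨(key _ _ h5 (by omega) (by omega)).1.symm, show l _ = 1 by omega⟩) ⟨_, rfl⟩
  obtain ⟨g, rfl, hgl, hg⟩ := h.exists_geodesic hyinf
  obtain ⟨h0, hk⟩ := key (g 1) (g 0) ((hg _ _).2 (by simp)) (by rw [hgl]; omega) hy1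
  have hfar : ∀ m n, G.Adj (f m) (g n) → n = 0 := by
    intro m n hmn
    have := h.le_succ hmn.symm
    rw [hgl, hl0] at this
    omega
  -- If `y` sees both `f 0` and `f 1`, omitting `f 0` leaves a single edge between the two rays.
  by_cases h1 : G.Adj (g 0) (f 1)
  · refine ⟨_, (hf.comp_add 1).glue hg fun m n => ⟨fun hmn => ?_, ?_⟩⟩
    · obtain rfl := hfar _ _ hmn
      have := hk _ hmn.symm
      omega
    · rintro ⟨rfl, rfl⟩
      exact h1.symm
  · refine ⟨_, hf.glue hg fun m n => ⟨fun hmn => ?_, ?_⟩⟩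
    · obtain rfl := hfar _ _ hmn
      have := hk _ hmn.symm
      obtain rfl | rfl : m = 0 ∨ m = 1 := by omega
      · simp
      · exact absurd hmn.symm h1
    · rintro ⟨rfl, rfl⟩
      exact h0.symm

/-! ### Spanning rays from clique layers -/

/-- If the layers `k = i` are finite cliques and every vertex `a` is adjacent to some vertex of the
next layer that depends only on the layer of `a`, then `V` has a locally finite linear order,
refining the order of the layers, in which consecutive vertices are adjacent. -/
theorem exists_linearOrder_of_layers {k : V → ℤ} (hfin : ∀ i, {v | k v = i}.Finite)
    (hclique : ∀ a b, k a = k b → a ≠ b → G.Adj a b) {s : ℤ → V}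
    (hs : ∀ a, k (s (k a)) = k a + 1) (hadj : ∀ a, G.Adj a (s (k a))) :
    ∃ _ : LinearOrder V, (∀ a b : V, k a < k b → a < b) ∧
      (∀ a b : V, (Set.Icc a b).Finite) ∧ ∀ a b : V, a ⋖ b → G.Adj a b := by
  classical
  -- Order by layer, put the entry vertex `s (k v - 1)` first within its layer, and break the
  -- remaining ties arbitrarily.
  let φ : V → ℤ ×ₗ (ℕ ×ₗ Cardinal) := fun v =>
    toLex (k v, toLex (if v = s (k v - 1) then 0 else 1, embeddingToCardinal v))
  have hφ : Function.Injective φ := fun a b h => by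
    have := congrArg (fun x => (ofLex (ofLex x).2).2) h
    exact embeddingToCardinal.injective this
  let o : LinearOrder V := LinearOrder.lift' φ hφ
  have hlt : ∀ a b : V, k a < k b → a < b := fun a b h =>
    Prod.Lex.toLex_lt_toLex.2 (Or.inl h)
  have hle : ∀ a b : V, a ≤ b → k a ≤ k b := by
    intro a b hab
    by_contra! h
    exact (hlt b a h).not_ge hab
  have hfirst : ∀ a b : V, k a = k b → a = s (k a - 1) → a ≤ b := by
    intro a b hab ha
    by_cases hba : b = s (k b - 1)
    · rw [hba, ← hab, ← ha]
    · refine le_of_lt (Prod.Lex.toLex_lt_toLex.2 (Or.inr ⟨hab, Prod.Lex.toLex_lt_toLex.2 ?_⟩))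
      left
      dsimp only
      rw [if_pos ha, if_neg hba]
      exact Nat.zero_lt_one
  refine ⟨o, hlt, fun a b => ?_, fun a b hab => ?_⟩
  · refine ((Set.finite_Icc (k a) (k b)).biUnion (t := fun i => {v | k v = i})
      fun i _ => hfin i).subset fun v hv => ?_
    exact Set.mem_biUnion (show k v ∈ _ from ⟨hle _ _ hv.1, hle _ _ hv.2⟩) rfl
  · obtain h | h := (hle a b hab.le).eq_or_lt
    · exact hclique a b h hab.ne
    · have h1 : a < s (k a) := hlt _ _ (by rw [hs]; omega)
      have h2 : s (k a) ≤ b := by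
        obtain h3 | h3 : k a + 1 = k b ∨ k a + 1 < k b := by omega
        · exact hfirst _ _ (by rw [hs, h3]) (by rw [hs, add_sub_cancel_right])
        · exact (hlt _ _ (by rw [hs]; exact h3)).le
      obtain rfl | h3 := h2.eq_or_lt
      · exact hadj a
      · exact absurd h3 (hab.2 h1)

/-- The layers `k = i` of vertices whose last neighbour on the path `f` is `f i` are cliques in a
claw-free graph. -/
theorem exists_linearOrder_of_last_adj [G.LocallyFinite] (hclaw : IsInducedFree claw G)
    {k : V → ℤ} {f : ℤ → V} (h1 : ∀ v, G.Adj v (f (k v))) (h2 : ∀ v, ¬ G.Adj v (f (k v + 1)))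
    (h3 : ∀ v, k (f (k v)) = k v + 1) :
    ∃ _ : LinearOrder V, (∀ a b : V, k a < k b → a < b) ∧
      (∀ a b : V, (Set.Icc a b).Finite) ∧ ∀ a b : V, a ⋖ b → G.Adj a b := by
  have hne : ∀ v, v ≠ f (k v + 1) := fun v h => by
    have h4 := congrArg f (h3 v)
    have h5 := h3 (f (k v))
    rw [h4, ← h, h3] at h5
    omega
  refine exists_linearOrder_of_layers (s := f) (fun i => ?_) (fun a b hab hne' => ?_) h3 h1
  · refine (finite_setOf_adj (G := G) (f i)).subset ?_
    rintro v rfl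
    exact (h1 v).symm
  -- The claw has centre `f (k a)` and leaves `a`, `b`, `f (k a + 1)`; neither `a` nor `b` sees the
  -- last leaf.
  · have h4 := h1 (f (k a))
    rw [h3] at h4
    rcases hclaw.adj_of_claw (h1 a).symm (hab ▸ (h1 b).symm) h4 hne' (hne a) (hab ▸ hne b)
      with h | h | h
    · exact h
    · exact absurd h (h2 a)
    · exact absurd h (hab ▸ h2 b)

theorem exists_isSpanning_ray_of_covBy [LinearOrder V] [NoMaxOrder V] [OrderBot V]
    (hIcc : ∀ a b : V, (Set.Icc a b).Finite) (hcov : ∀ a b : V, a ⋖ b → G.Adj a b) :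
    ∃ R : G.Ray, R.IsSpanning := by
  let _ := LocallyFiniteOrder.ofFiniteIcc hIcc
  let _ := LinearLocallyFiniteOrder.succOrder V
  let _ := LinearLocallyFiniteOrder.predOrder V
  let e : V ≃o ℕ := orderIsoNatOfLinearSuccPredArch
  exact ⟨⟨e.symm, e.symm.injective,
    fun n => hcov _ _ ((apply_covBy_apply_iff e.symm).2 (Order.covBy_add_one n))⟩,
    e.symm.surjective⟩

theorem exists_isSpanning_doubleRay_of_covBy [LinearOrder V] [NoMaxOrder V] [NoMinOrder V]
    [Nonempty V] (hIcc : ∀ a b : V, (Set.Icc a b).Finite)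
    (hcov : ∀ a b : V, a ⋖ b → G.Adj a b) :
    ∃ D : G.DoubleRay, D.IsSpanning := by
  let _ := LocallyFiniteOrder.ofFiniteIcc hIcc
  let _ := LinearLocallyFiniteOrder.succOrder V
  let _ := LinearLocallyFiniteOrder.predOrder V
  let e : V ≃o ℤ := orderIsoIntOfLinearSuccPredArch
  exact ⟨⟨e.symm, e.symm.injective,
    fun n => hcov _ _ ((apply_covBy_apply_iff e.symm).2 (Order.covBy_add_one n))⟩,
    e.symm.surjective⟩

theorem IsInducedRay.exists_isSpanning [G.LocallyFinite] (hclaw : IsInducedFree claw G)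
    {f : ℕ → V} (hf : G.IsInducedRay f) (hdom : ∀ v, ∃ i, G.Adj v (f i)) :
    ∃ R : G.Ray, R.IsSpanning := by
  have hlast : ∀ v, ∃ i, G.Adj v (f i) ∧ ∀ j, G.Adj v (f j) → j ≤ i := fun v => by
    obtain ⟨j, hj⟩ := hdom v
    obtain ⟨i, hi, -, h⟩ := exists_last_adj hf.injective hj
    exact ⟨i, hi, h⟩
  choose k hk hmax using hlast
  have hkf : ∀ i, k (f i) = i + 1 := fun i =>
    le_antisymm (by have := (hf _ _).1 (hk (f i)); omega) (hmax _ _ ((hf _ _).2 (by simp)))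
  -- The value `f 0` at negative indices is harmless: the hypotheses only involve indices at least
  -- `k v ≥ 0`.
  obtain ⟨_, hlt, hIcc, hcov⟩ := exists_linearOrder_of_last_adj hclaw (k := fun v => (k v : ℤ))
    (f := fun i => f i.toNat) (fun v => by simpa using hk v)
    (fun v h => by have := hmax _ _ h; omega) (fun v => by simp [hkf])
  have : NoMaxOrder V := ⟨fun a => ⟨f (k a), hlt _ _ (by simp [hkf])⟩⟩
  -- Since `f 0` is in layer 1, everything below it lies in layers 0 and 1.
  have hIic : (Set.Iic (f 0)).Finite := by
    refine ((Set.finite_Icc 0 1).biUnion (t := fun i => {v | G.Adj (f i) v})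
      fun i _ => finite_setOf_adj _).subset fun v hv => ?_
    refine Set.mem_biUnion (show k v ∈ _ from ⟨Nat.zero_le _, ?_⟩) (hk v).symm
    by_contra! h
    exact (hlt (f 0) v (by rw [hkf]; exact_mod_cast h)).not_ge hv
  obtain ⟨b, hb, hmin⟩ := Set.exists_min_image _ id hIic ⟨f 0, le_rfl⟩
  let _ : OrderBot V := @OrderBot.mk V _ ⟨b⟩ fun v => (le_total v (f 0)).elim (hmin v) (le_trans hb)
  exact exists_isSpanning_ray_of_covBy hIcc hcov

theorem IsInducedDoubleRay.exists_isSpanning [G.LocallyFinite] (hclaw : IsInducedFree claw G)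
    {f : ℤ → V} (hf : G.IsInducedDoubleRay f) (hdom : ∀ v, ∃ i, G.Adj v (f i)) :
    ∃ D : G.DoubleRay, D.IsSpanning := by
  have hlast : ∀ v, ∃ i, G.Adj v (f i) ∧ ∀ j, G.Adj v (f j) → j ≤ i := fun v => by
    obtain ⟨j, hj⟩ := hdom v
    obtain ⟨i, hi, -, h⟩ := exists_last_adj hf.injective hj
    exact ⟨i, hi, h⟩
  choose k hk hmax using hlast
  have hkf : ∀ i, k (f i) = i + 1 := fun i =>
    le_antisymm (by have := (hf _ _).1 (hk (f i)); omega) (hmax _ _ ((hf _ _).2 (by simp)))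
  obtain ⟨_, hlt, hIcc, hcov⟩ := exists_linearOrder_of_last_adj hclaw hk
    (fun v h => by have := hmax _ _ h; omega) (fun v => hkf _)
  have : NoMaxOrder V := ⟨fun a => ⟨f (k a), hlt _ _ (by simp [hkf])⟩⟩
  -- As `k (f i) = i + 1`, the vertex `f (k a - 2)` is in layer `k a - 1`.
  have : NoMinOrder V := ⟨fun a => ⟨f (k a - 2), hlt _ _ (by rw [hkf]; omega)⟩⟩
  have : Nonempty V := ⟨f 0⟩
  exact exists_isSpanning_doubleRay_of_covBy hIcc hcov

/-! ### Ends -/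

theorem Ray.HasTailIn.eq_of_mem {R : G.Ray} {S : Set V} {C D : G.ComponentCompl S}
    (hC : R.HasTailIn C) (hD : ∃ᶠ n in atTop, R.vert n ∈ D) : C = D := by
  obtain ⟨N, hN⟩ := hC
  obtain ⟨n, hn, hnD⟩ := frequently_atTop.1 hD N
  obtain ⟨_, h1⟩ := hN n hn
  obtain ⟨_, h2⟩ := hnD
  exact h1.symm.trans h2

theorem Ray.eventually_notMem (R : G.Ray) {S : Set V} (hS : S.Finite) :
    ∀ᶠ n in atTop, R.vert n ∉ S := by
  rw [← Nat.cofinite_eq_atTop]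
  exact R.injective.tendsto_cofinite.eventually hS.compl_mem_cofinite

/-- If `R` is adjacent infinitely often to every tail of `Q`, then no finite set separates `R`
from `Q`. -/
theorem Ray.mem_of_frequently_adj {R Q : G.Ray} {S : Finset V}
    {C : G.ComponentCompl (S : Set V)} (hC : Q.HasTailIn C)
    (h : ∀ N, ∃ᶠ n in atTop, ∃ i ≥ N, G.Adj (R.vert n) (Q.vert i)) : R.HasTailIn C := by
  obtain ⟨D, hD⟩ := R.exists_hasTailIn S
  obtain ⟨N, hN⟩ := hC
  rwa [← hD.eq_of_mem (D := C)]
  refine ((h N).and_eventually (R.eventually_notMem S.finite_toSet)).mono ?_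
  rintro n ⟨⟨i, hi, hadj⟩, hn⟩
  exact ComponentCompl.mem_of_adj _ _ (hN i hi) hn hadj.symm

/-- Late vertices of any ray avoid the finite neighbourhood of an initial segment of `R`, so their
neighbours on `R` lie in a tail of `R`. -/
theorem natCard_rayEnd_eq_one [G.LocallyFinite] (R : G.Ray)
    (hdom : ∀ v, ∃ i, G.Adj v (R.vert i)) : Nat.card G.RayEnd = 1 := by
  refine Nat.card_eq_one_iff_exists.2 ⟨Quotient.mk _ R, fun x => ?_⟩
  induction x using Quotient.inductionOn with
  | _ Q =>
    refine Quotient.sound fun S => ?_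
    obtain ⟨C, hC⟩ := R.exists_hasTailIn S
    refine ⟨C, Q.mem_of_frequently_adj hC fun N => Eventually.frequently ?_, hC⟩
    have hfin := (Set.finite_Iio N).biUnion (t := fun i => {w | G.Adj (R.vert i) w})
      fun i _ => finite_setOf_adj _
    filter_upwards [Q.eventually_notMem hfin] with n hn
    obtain ⟨i, hi⟩ := hdom (Q.vert n)
    refine ⟨i, ?_, hi⟩
    by_contra! h
    exact hn (Set.mem_biUnion (show i ∈ _ from h) hi.symm)

theorem equivalent_or_equivalent [G.LocallyFinite] {P M : G.Ray}
    (hdom : ∀ v, (∃ i, G.Adj v (P.vert i)) ∨ ∃ i, G.Adj v (M.vert i)) (Q : G.Ray) :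
    Q.Equivalent P ∨ Q.Equivalent M := by
  have hev : ∀ N, ∀ᶠ n in atTop, (∃ i ≥ N, G.Adj (Q.vert n) (P.vert i)) ∨
      ∃ i ≥ N, G.Adj (Q.vert n) (M.vert i) := by
    intro N
    have hfin := fun R : G.Ray => (Set.finite_Iio N).biUnion
      (t := fun i => {w | G.Adj (R.vert i) w}) fun i _ => finite_setOf_adj _
    filter_upwards [Q.eventually_notMem (hfin P), Q.eventually_notMem (hfin M)] with n hP hM
    refine (hdom (Q.vert n)).imp ?_ ?_
    · rintro ⟨i, hi⟩
      refine ⟨i, ?_, hi⟩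
      by_contra! h
      exact hP (Set.mem_biUnion (show i ∈ _ from h) hi.symm)
    · rintro ⟨i, hi⟩
      refine ⟨i, ?_, hi⟩
      by_contra! h
      exact hM (Set.mem_biUnion (show i ∈ _ from h) hi.symm)
  by_cases hP : ∀ N, ∃ᶠ n in atTop, ∃ i ≥ N, G.Adj (Q.vert n) (P.vert i)
  · left
    intro S
    obtain ⟨C, hC⟩ := P.exists_hasTailIn S
    exact ⟨C, Q.mem_of_frequently_adj hC hP, hC⟩
  · right
    intro S
    obtain ⟨C, hC⟩ := M.exists_hasTailIn S
    refine ⟨C, Q.mem_of_frequently_adj hC fun N => Eventually.frequently ?_, hC⟩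
    simp only [not_forall, not_frequently] at hP
    obtain ⟨N', hN'⟩ := hP
    filter_upwards [hN', hev (max N N')] with n h1 h2
    obtain ⟨i, hi, h⟩ | ⟨i, hi, h⟩ := h2
    · exact absurd ⟨i, le_of_max_le_right hi, h⟩ h1
    · exact ⟨i, le_of_max_le_left hi, h⟩

theorem ComponentCompl.mem_of_closed {S : Set V} (C : G.ComponentCompl S) {A : Set V}
    (hA : ∀ u ∈ A, ∀ v ∉ S, G.Adj u v → v ∈ A) {u v : V} (hu : u ∈ C) (hv : v ∈ C) (huA : u ∈ A) :
    v ∈ A := by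
  obtain ⟨hu, rfl⟩ := hu
  obtain ⟨hv, h⟩ := hv
  obtain ⟨p⟩ := ConnectedComponent.exact h.symm
  by_contra hvA
  obtain ⟨d, -, h1, h2⟩ := p.exists_boundary_dart {x | x.1 ∈ A} huA hvA
  exact h2 (hA _ h1 _ d.snd.2 d.adj)

namespace IsInducedDoubleRay

variable {f : ℤ → V}

/-- The positive half of an induced double ray. -/
def posRay (hf : G.IsInducedDoubleRay f) : G.Ray where
  vert n := f n
  injective := hf.injective.comp Nat.cast_injective
  adj n := (hf _ _).2 (by simp)

/-- The negative half of an induced double ray. -/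
def negRay (hf : G.IsInducedDoubleRay f) : G.Ray where
  vert n := f (-n)
  injective := hf.injective.comp (neg_injective.comp Nat.cast_injective)
  adj n := (hf _ _).2 (by right; push_cast; ring)

/-- The forbidden configuration is placed at the last neighbour of `v` with negative index. It uses
only indices at most 0, so only there must `w` have no neighbours. -/
theorem false_of_adj_neg [G.LocallyFinite] (hclaw : IsInducedFree claw G)
    (hnet : IsInducedFree net G) (hf : G.IsInducedDoubleRay f) {v w : V} {j : ℤ} (hj : j < 0)
    (hvj : G.Adj v (f j)) (hv0 : ¬ G.Adj v (f 0)) (hvf : ∀ i, v ≠ f i) (hvw : G.Adj v w)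
    (hw : ∀ i ≤ 0, ¬ G.Adj w (f i)) : False := by
  obtain ⟨i, ⟨hi, hi0⟩, hmax⟩ := Set.exists_max_image {i | G.Adj v (f i) ∧ i < 0} id
    ((finite_setOf_adj_apply hf.injective v).subset fun _ h => h.1) ⟨j, hvj, hj⟩
  refine false_of_induced_path hclaw hnet (a := f (i - 2)) (b := f (i - 1)) (c := f i)
    (d := f (i + 1)) (v := v) (w := w) ?_ ?_ ?_ ?_ ?_ ?_ hi (fun h => ?_) hvw (hvf _) (hvf _)
    (hw _ (by omega)) (hw _ (by omega)) (hw _ (by omega)) (hw _ (by omega))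
  any_goals rw [hf]; omega
  obtain h0 | h0 : i + 1 = 0 ∨ i + 1 < 0 := by omega
  · exact hv0 (h0 ▸ h)
  · have : i + 1 ≤ i := hmax _ ⟨h, h0⟩
    omega

/-- Delete the neighbours of `f 0` and `f 1`. Among the remaining vertices, those with a neighbour
`f i`, `i ≥ 2`, have none of negative index and are closed under adjacency, both by
`false_of_adj_neg`. A tail of the positive half lies in this set and the negative half avoids it. -/
theorem not_equivalent [G.LocallyFinite] (hclaw : IsInducedFree claw G)
    (hnet : IsInducedFree net G) (hf : G.IsInducedDoubleRay f) (hdom : ∀ v, ∃ i, G.Adj v (f i)) :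
    ¬ hf.posRay.Equivalent hf.negRay := by
  intro heq
  have hfin := (finite_setOf_adj (G := G) (f 0)).union (finite_setOf_adj (G := G) (f 1))
  obtain ⟨C, ⟨N, hN⟩, M, hM⟩ := heq hfin.toFinset
  have hS : ∀ v, v ∉ (hfin.toFinset : Set V) ↔ ¬ G.Adj v (f 0) ∧ ¬ G.Adj v (f 1) := by
    intro v
    simp [G.adj_comm v]
  have hdisj : ∀ v, ¬ G.Adj v (f 0) → ¬ G.Adj v (f 1) → ∀ i, 2 ≤ i → G.Adj v (f i) →
      ∀ j < 0, ¬ G.Adj v (f j) := by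
    intro v h0 h1 i hi hvi j hj hvj
    refine hf.false_of_adj_neg hclaw hnet hj hvj h0 ?_ hvi fun m hm => by rw [hf]; omega
    rintro l rfl
    rw [hf] at hvi hvj
    omega
  have hA : ∀ u ∈ {v | ∃ i, 2 ≤ i ∧ G.Adj v (f i)} ∩ (hfin.toFinset : Set V)ᶜ,
      ∀ v ∉ (hfin.toFinset : Set V), G.Adj u v →
      v ∈ {v | ∃ i, 2 ≤ i ∧ G.Adj v (f i)} ∩ (hfin.toFinset : Set V)ᶜ := by
    rintro u ⟨⟨i, hi, hui⟩, huS⟩ v hvS huv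
    refine ⟨?_, hvS⟩
    obtain ⟨hv0, hv1⟩ := (hS v).1 hvS
    obtain ⟨hu0, hu1⟩ := (hS u).1 huS
    have hu := hdisj u hu0 hu1 i hi hui
    by_contra! hvA
    obtain ⟨j, hj⟩ := hdom v
    have hj2 : j < 2 := by
      by_contra! h
      exact hvA ⟨j, h, hj⟩
    have hjne : j ≠ 0 ∧ j ≠ 1 := ⟨by rintro rfl; exact hv0 hj, by rintro rfl; exact hv1 hj⟩
    -- Here `u` is the neighbour of `v` that sees nothing on the nonpositive half.
    refine hf.false_of_adj_neg hclaw hnet (show j < 0 by omega) hj hv0 ?_ huv.symm fun m hm => ?_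
    · rintro l rfl
      have hl0 : l ≠ 0 := by rintro rfl; exact hu0 huv
      have hl1 : l ≠ 1 := by rintro rfl; exact hu1 huv
      have hl : ¬ l < 0 := fun h => hu l h huv
      exact hvA ⟨l + 1, by omega, (hf _ _).2 (by simp)⟩
    · obtain rfl | hm := hm.eq_or_lt
      · exact hu0
      · exact hu m hm
  have hpos : f ((max N 3 : ℕ) : ℤ) ∈ C := hN _ (le_max_left _ _)
  have hneg : f (-(M : ℤ)) ∈ C := hM _ le_rfl
  obtain ⟨⟨i, hi, h⟩, -⟩ := C.mem_of_closed hA hpos hneg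
    ⟨⟨_, (by omega : (2 : ℤ) ≤ ((max N 3 : ℕ) : ℤ) + 1), (hf _ _).2 (Or.inl rfl)⟩,
      C.notMem_of_mem hpos⟩
  rw [hf] at h
  omega

theorem natCard_rayEnd_eq_two [G.LocallyFinite] (hclaw : IsInducedFree claw G)
    (hnet : IsInducedFree net G) (hf : G.IsInducedDoubleRay f) (hdom : ∀ v, ∃ i, G.Adj v (f i)) :
    Nat.card G.RayEnd = 2 := by
  refine Nat.card_eq_two_iff.2 ⟨Quotient.mk _ hf.posRay, Quotient.mk _ hf.negRay,
    fun h => hf.not_equivalent hclaw hnet hdom (Quotient.exact h),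
    Set.eq_univ_of_forall fun x => ?_⟩
  induction x using Quotient.inductionOn with
  | _ Q =>
    refine (equivalent_or_equivalent (P := hf.posRay) (M := hf.negRay) (fun v => ?_) Q).imp
      (fun h => Quotient.sound h) (fun h => Quotient.sound h)
    obtain ⟨i, hi⟩ := hdom v
    obtain ⟨_, rfl | rfl⟩ := i.eq_nat_or_neg
    · exact Or.inl ⟨_, hi⟩
    · exact Or.inr ⟨_, hi⟩

end IsInducedDoubleRay

/-- The induced ray `f` as a ray. -/
def IsInducedRay.toRay {f : ℕ → V} (hf : G.IsInducedRay f) : G.Ray where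
  vert := f
  injective := hf.injective
  adj _ := (hf _ _).2 (Or.inl rfl)

end SimpleGraph

theorem mainTheorem3 {V : Type*} [Infinite V] (G : SimpleGraph V) [G.LocallyFinite]
    (hconn : G.Connected) (hclaw : SimpleGraph.IsInducedFree SimpleGraph.claw G)
    (hnet : SimpleGraph.IsInducedFree SimpleGraph.net G) :
    Xor
      (Nat.card G.RayEnd = 1 ∧ ∃ R : G.Ray, R.IsSpanning)
      (Nat.card G.RayEnd = 2 ∧ ∃ D : G.DoubleRay, D.IsSpanning) := by
  obtain ⟨f, hf⟩ := SimpleGraph.exists_isInducedRay hconn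
  by_cases hfin : (G.undominated f).Finite
  · obtain ⟨g, hg, hdom⟩ := hf.exists_dominating hconn hclaw hnet hfin
    have hcard := SimpleGraph.natCard_rayEnd_eq_one hg.toRay hdom
    exact Or.inl ⟨⟨hcard, hg.exists_isSpanning hclaw hdom⟩, fun h => by omega⟩
  · obtain ⟨g, hg⟩ := hf.exists_isInducedDoubleRay hconn hclaw hnet hfin
    have hdom := hg.dominating hconn hclaw hnet
    have hcard := hg.natCard_rayEnd_eq_two hclaw hnet hdom
    exact Or.inr ⟨⟨hcard, hg.exists_isSpanning hclaw hdom⟩, fun h => by omega⟩
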